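/- Let $\mathbb N=\{1,2,3,\dots\}$. For an irrational number $x\in(0,1)$ let $a_1(x),a_2(x),\dots\in\mathbb N$ be the partial quotients of its continued fraction expansion $x=1/(a_1(x)+1/(a_2(x)+\cdots))$; that is, $a_n(x)=\lfloor 1/T^{n-1}(x)\rfloor$, where $T(x)=1/x-\lfloor 1/x\rfloor$ is the Gauss map. For an infinite set $B\subseteq\mathbb N$ let \[\tau(B)=\inf\Big\{s\ge 0:\ \sum_{k\in B}k^{-s}<\infty\Big\}\] be its exponent of convergence. Then for every infinite subset $B$ of $\mathbb N$ and every function $f\colon\mathbb N\to[\min B,\infty)$ with $\lim_{n\to\infty}f(n)=\infty$, the set \[G(B,f)=\Big\{x\in(0,1)\setminus\mathbb Q:\ a_n(x)\in B\ \text{and}\ a_n(x)\le f(n)\ \text{for all } n\in\mathbb N,\ \text{and}\ \lim_{n\to\infty}a_n(x)=\infty\Big\}\] has Hausdorff dimension $\tau(B)/2$. -/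

import Mathlib

/-- The Gauss map `T x = 1 / x - ⌊1 / x⌋`. -/
noncomputable def gaussMap (x : ℝ) : ℝ := 1 / x - (⌊1 / x⌋ : ℝ)

/-- The `n`-th partial quotient `a_n(x) = ⌊1 / T^(n-1) x⌋` of the continued fraction expansion
`x = 1 / (a_1(x) + 1 / (a_2(x) + ⋯))` of an irrational number `x ∈ (0, 1)`. The index starts
at `n = 1`; the value at `n = 0` is never used. -/
noncomputable def partialQuotient (x : ℝ) (n : ℕ) : ℕ := ⌊1 / (gaussMap^[n - 1] x)⌋₊

/-- The irrational numbers of the open unit interval. -/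
def unitIrrationals : Set ℝ := {x | Irrational x ∧ x ∈ Set.Ioo (0 : ℝ) 1}

/-- The exponent of convergence of a set `B` of positive integers. -/
noncomputable def convergenceExponent (B : Set ℕ) : ℝ :=
  sInf {s : ℝ | 0 ≤ s ∧ Summable (fun k : B => ((k : ℕ) : ℝ) ^ (-s))}

/-- The irrational `x ∈ (0, 1)` whose partial quotients lie in `B`, are bounded by `f`, and tend
to infinity. -/
def restrictedSlowSet (B : Set ℕ) (f : ℕ → ℝ) : Set ℝ :=
  {x | x ∈ unitIrrationals ∧
    (∀ n : ℕ, 1 ≤ n → partialQuotient x n ∈ B ∧ (partialQuotient x n : ℝ) ≤ f n) ∧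
    Filter.Tendsto (fun n : ℕ => partialQuotient x n) Filter.atTop Filter.atTop}

theorem gaussMap_mem_unitIrrationals {x : ℝ} (hx : x ∈ unitIrrationals) :
    gaussMap x ∈ unitIrrationals := by
  have h1 : Irrational (gaussMap x) := by
    have h : Irrational (1 / x) := by simpa using hx.1.inv
    exact h.sub_intCast _
  have h2 : 0 ≤ gaussMap x := Int.fract_nonneg (1 / x)
  exact ⟨h1, lt_of_le_of_ne h2 (Ne.symm h1.ne_zero), Int.fract_lt_one (1 / x)⟩

theorem iterate_gaussMap_mem_unitIrrationals {x : ℝ} (hx : x ∈ unitIrrationals) (n : ℕ) :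
    gaussMap^[n] x ∈ unitIrrationals := by
  induction n with
  | zero => simpa using hx
  | succ n ih =>
    rw [Function.iterate_succ_apply']
    exact gaussMap_mem_unitIrrationals ih

/-- The partial quotients agree with those of Mathlib's continued fraction of `x`. -/
theorem partDens_eq_partialQuotient {x : ℝ} (hx : x ∈ unitIrrationals) (n : ℕ) :
    (GenContFract.of x).partDens.get? (n - 1) = some (partialQuotient x n : ℝ) := by
  have key : ∀ k : ℕ, GenContFract.IntFractPair.stream x (k + 1) =
      some (GenContFract.IntFractPair.of (1 / (gaussMap^[k] x))) := by
    intro k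
    induction k with
    | zero =>
      have hf : Int.fract x = x := Int.fract_eq_self.2 ⟨hx.2.1.le, hx.2.2⟩
      rw [GenContFract.IntFractPair.stream_succ_of_some
        (GenContFract.IntFractPair.stream_zero x)]
      · simp [GenContFract.IntFractPair.of, hf]
      · simpa [GenContFract.IntFractPair.of, hf] using hx.2.1.ne'
    | succ k ih =>
      have hk := iterate_gaussMap_mem_unitIrrationals hx (k + 1)
      have hfr : (GenContFract.IntFractPair.of (1 / (gaussMap^[k] x))).fr =
          gaussMap^[k + 1] x := by
        rw [Function.iterate_succ_apply']; rfl
      rw [GenContFract.IntFractPair.stream_succ_of_some ih (by rw [hfr]; exact hk.2.1.ne'),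
        hfr, one_div]
  have h := GenContFract.get?_of_eq_some_of_succ_get?_intFractPair_stream (key (n - 1))
  rw [GenContFract.partDen_eq_s_b h]
  have hp : 0 ≤ 1 / (gaussMap^[n - 1] x) :=
    one_div_nonneg.2 (iterate_gaussMap_mem_unitIrrationals hx (n - 1)).2.1.le
  simp only [partialQuotient, GenContFract.IntFractPair.of]
  rw [natCast_floor_eq_intCast_floor hp]

open Filter Topology MeasureTheory Set
open scoped ENNReal NNReal

/-! Upper bound: let `s > τ(B)`. All but finitely many digits of a point of `G(B, f)` lie in a tail
`S` of `B` with `∑ k^(-s) ≤ 1` over `k ∈ S`. A cylinder with digits `w_1, …, w_n` has diameter at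
most `∏ w_i^(-2)`, so the `s/2`-powers of the diameters of the cylinders of order `n` over `S` sum
to at most `(∑ k^(-s))^n ≤ 1` (`dimH_digitSet_le`). Undoing finitely many steps of the Gauss map
does not raise the dimension.

Lower bound: let `0 < s < τ(B)`. `B` contains finite blocks `F`, arbitrarily far out, with elements
below some `V` and `card F ≥ 2 V^s` (`exists_block`). Digits are drawn from these blocks, moving
outwards so slowly that `V ≤ f` and `V^s ≤ 2^i` at time `i`; the early digits are `min B`. Mixed
radix expansions encode the choices by `y ∈ [0, 1)`. Points separating at digit `n` are at distance
at least about `∏_{i ≤ n} V_i^(-2)`, their codes at most `∏_{i < n} (card F_i)^(-1)`. The factors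
`2` in the cardinalities pay for the extra `V_n`, so decoding is `s/2`-Hölder onto an interval
(`le_dimH_of_blocks`). -/

/-! ### Inverse branches of the Gauss map and diameters of cylinders -/

theorem gaussMap_eq_fract (x : ℝ) : gaussMap x = Int.fract (1 / x) := rfl

theorem partialQuotient_one (x : ℝ) : partialQuotient x 1 = ⌊1 / x⌋₊ := rfl

theorem partialQuotient_iterate (x : ℝ) (m n : ℕ) :
    partialQuotient (gaussMap^[m] x) (n + 1) = partialQuotient x (n + m + 1) := by
  simp [partialQuotient, Function.iterate_add_apply]

theorem one_le_partialQuotient_one {x : ℝ} (hx : x ∈ unitIrrationals) :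
    1 ≤ partialQuotient x 1 := by
  rw [partialQuotient_one, Nat.one_le_floor_iff, le_div_iff₀ hx.2.1]
  linarith [hx.2.2]

theorem eq_inv_partialQuotient_add {x : ℝ} (hx : x ∈ unitIrrationals) :
    x = 1 / (partialQuotient x 1 + gaussMap x) := by
  have h : ((partialQuotient x 1 : ℕ) : ℝ) = (⌊1 / x⌋ : ℝ) := by
    rw [partialQuotient_one]
    exact natCast_floor_eq_intCast_floor (one_div_nonneg.2 hx.2.1.le)
  rw [h, gaussMap]
  simp

theorem inv_add_sub_inv_add {a u v : ℝ} (hu : a + u ≠ 0) (hv : a + v ≠ 0) :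
    1 / (a + u) - 1 / (a + v) = (1 / (a + u)) * (1 / (a + v)) * (v - u) := by
  field_simp
  ring

theorem abs_inv_add_sub_inv_add_le {a u v : ℝ} (ha : 0 < a) (hu : 0 ≤ u) (hv : 0 ≤ v) :
    |1 / (a + u) - 1 / (a + v)| ≤ (1 / a ^ 2) * |u - v| := by
  rw [inv_add_sub_inv_add (by positivity) (by positivity), abs_mul,
    abs_of_nonneg (show 0 ≤ 1 / (a + u) * (1 / (a + v)) by positivity), abs_sub_comm v u]
  gcongr
  rw [div_mul_div_comm, one_mul, sq]
  gcongr <;> linarith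

/-- Each inverse branch `u ↦ 1 / (a + u)` contracts `[0, ∞)` by the factor `a^(-2)`. -/
theorem abs_sub_le_prod_partialQuotient (n : ℕ) : ∀ {x y : ℝ}, x ∈ unitIrrationals →
    y ∈ unitIrrationals → (∀ i < n, partialQuotient x (i + 1) = partialQuotient y (i + 1)) →
    |x - y| ≤ ∏ i ∈ Finset.range n, 1 / (partialQuotient x (i + 1) : ℝ) ^ 2 := by
  induction n with
  | zero =>
    intro x y hx hy _
    rw [Finset.prod_range_zero, abs_le]
    constructor <;> linarith [hx.2.1, hx.2.2, hy.2.1, hy.2.2]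
  | succ n ih =>
    intro x y hx hy h
    have hstep := ih (gaussMap_mem_unitIrrationals hx) (gaussMap_mem_unitIrrationals hy)
      (fun i hi => h (i + 1) (by omega))
    have ha := one_le_partialQuotient_one hx
    have h0 : partialQuotient x 1 = partialQuotient y 1 := h 0 (by omega)
    rw [Finset.prod_range_succ', mul_comm]
    conv_lhs => rw [eq_inv_partialQuotient_add hx, eq_inv_partialQuotient_add hy, ← h0]
    refine (abs_inv_add_sub_inv_add_le (by positivity)
      (gaussMap_mem_unitIrrationals hx).2.1.le (gaussMap_mem_unitIrrationals hy).2.1.le).trans ?_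
    exact mul_le_mul_of_nonneg_left hstep (by positivity)

/-! ### Upper bound: coverings by cylinders -/

theorem ENNReal.tsum_prod_fin {β : Type*} (c : β → ℝ≥0∞) (n : ℕ) :
    ∑' w : Fin n → β, ∏ i, c (w i) = (∑' b, c b) ^ n := by
  induction n with
  | zero => simp
  | succ n ih =>
    rw [← (Fin.consEquiv fun _ : Fin (n + 1) => β).tsum_eq, ENNReal.tsum_prod']
    simp only [Fin.consEquiv, Equiv.coe_fn_mk, Fin.prod_univ_succ, Fin.cons_zero, Fin.cons_succ,
      ENNReal.tsum_mul_left, ih, ENNReal.tsum_mul_right, pow_succ']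

/-- The irrationals of the unit interval whose partial quotients all lie in `S`. -/
def digitSet (S : Set ℕ) : Set ℝ :=
  {x | x ∈ unitIrrationals ∧ ∀ n : ℕ, partialQuotient x (n + 1) ∈ S}

/-- The cylinders of order `n` have covering sum at most the `n`-th power of a number `≤ 1`; digits
at least `2` force their diameters below `4^(-n)`. -/
theorem dimH_digitSet_le {S : Set ℕ} (hS : ∀ k ∈ S, 2 ≤ k) {s : ℝ} (hs : 0 ≤ s)
    (hsum : ∑' k : S, ENNReal.ofReal (((k : ℕ) : ℝ) ^ (-s)) ≤ 1) :
    dimH (digitSet S) ≤ ENNReal.ofReal (s / 2) := by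
  set I : (n : ℕ) → (Fin n → S) → Set ℝ := fun n w =>
    {x | x ∈ unitIrrationals ∧ ∀ i : Fin n, partialQuotient x (i + 1) = w i} with hI
  have hdiam : ∀ n (w : Fin n → S),
      Metric.ediam (I n w) ≤ ENNReal.ofReal (∏ i, 1 / ((w i : ℕ) : ℝ) ^ 2) := by
    intro n w
    refine Metric.ediam_le fun x hx y hy => ?_
    rw [edist_dist, Real.dist_eq]
    refine ENNReal.ofReal_le_ofReal ?_
    have := abs_sub_le_prod_partialQuotient n hx.1 hy.1
      (fun i hi => (hx.2 ⟨i, hi⟩).trans (hy.2 ⟨i, hi⟩).symm)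
    refine this.trans_eq ?_
    rw [← Fin.prod_univ_eq_prod_range (fun i => 1 / (partialQuotient x (i + 1) : ℝ) ^ 2)]
    exact Finset.prod_congr rfl fun i _ => by rw [hx.2 i]
  have hpos : ∀ k : S, (0 : ℝ) < ((k : ℕ) : ℝ) := fun k => by
    have := hS k k.2
    positivity
  have hterm : ∀ n (w : Fin n → S), Metric.ediam (I n w) ^ (s / 2) ≤
      ∏ i, ENNReal.ofReal (((w i : ℕ) : ℝ) ^ (-s)) := by
    intro n w
    refine (ENNReal.rpow_le_rpow (hdiam n w) (by positivity)).trans_eq ?_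
    rw [ENNReal.ofReal_rpow_of_nonneg (Finset.prod_nonneg fun i _ => by positivity)
      (by positivity), ← Real.finsetProd_rpow _ _ (fun i _ => by positivity),
      ENNReal.ofReal_prod_of_nonneg (fun i _ => by positivity)]
    refine Finset.prod_congr rfl fun i _ => ?_
    congr 1
    rw [one_div, Real.inv_rpow (by positivity), ← Real.rpow_natCast,
      ← Real.rpow_mul (hpos _).le, Real.rpow_neg (hpos _).le]
    congr 2
    push_cast
    ring
  have hmeas : μH[s / 2] (digitSet S) ≤ 1 := by
    refine (Measure.hausdorffMeasure_le_liminf_tsum (s / 2) (digitSet S) (l := atTop)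
      (fun n : ℕ => ENNReal.ofReal ((1 / 4) ^ n)) ?_ I ?_ ?_).trans ?_
    · rw [← ENNReal.ofReal_zero]
      exact ENNReal.tendsto_ofReal
        (tendsto_pow_atTop_nhds_zero_of_lt_one (by norm_num) (by norm_num))
    · refine Eventually.of_forall fun n w => (hdiam n w).trans (ENNReal.ofReal_le_ofReal ?_)
      refine (Finset.prod_le_prod (g := fun _ => (1 / 4 : ℝ)) (fun i _ => by positivity)
        fun i _ => ?_).trans_eq (by simp)
      have h2 : (2 : ℝ) ≤ ((w i : ℕ) : ℝ) := by exact_mod_cast hS _ (w i).2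
      gcongr
      nlinarith
    · refine Eventually.of_forall fun n x hx => ?_
      exact mem_iUnion.2 ⟨fun i => ⟨_, hx.2 i⟩, hx.1, fun i => rfl⟩
    · refine (liminf_le_liminf (v := fun _ : ℕ => (1 : ℝ≥0∞)) (Eventually.of_forall fun n => ?_)
        ).trans_eq (by simp)
      refine (ENNReal.tsum_le_tsum (hterm n)).trans ?_
      rw [ENNReal.tsum_prod_fin (fun k : S => ENNReal.ofReal (((k : ℕ) : ℝ) ^ (-s)))]
      exact pow_le_one₀ (by positivity) hsum
  have := dimH_le_of_hausdorffMeasure_ne_top (s := digitSet S) (d := (s / 2).toNNReal)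
    (by rw [Real.coe_toNNReal _ (by positivity)]; exact (hmeas.trans_lt ENNReal.one_lt_top).ne)
  exact this

/-- There are countably many inverse branches, each `1`-Lipschitz on `[0, ∞)`. -/
theorem dimH_gaussMap_preimage_le (A : Set ℝ) :
    dimH {x | x ∈ unitIrrationals ∧ gaussMap x ∈ A} ≤ dimH A := by
  have hsub : {x | x ∈ unitIrrationals ∧ gaussMap x ∈ A} ⊆
      ⋃ a : ℕ, (fun u : ℝ => 1 / (((a + 1 : ℕ) : ℝ) + u)) '' (A ∩ Ici 0) := by
    rintro x ⟨hx, hA⟩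
    obtain ⟨a, ha⟩ := Nat.exists_eq_add_of_le' (one_le_partialQuotient_one hx)
    refine mem_iUnion.2 ⟨a, gaussMap x, ⟨hA, (gaussMap_mem_unitIrrationals hx).2.1.le⟩, ?_⟩
    simp only [← ha]
    exact (eq_inv_partialQuotient_add hx).symm
  refine (dimH_mono hsub).trans ?_
  rw [dimH_iUnion]
  refine iSup_le fun a => ?_
  have hlip : LipschitzOnWith 1 (fun u : ℝ => 1 / (((a + 1 : ℕ) : ℝ) + u)) (A ∩ Ici 0) := by
    refine LipschitzOnWith.of_dist_le_mul fun u hu v hv => ?_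
    rw [Real.dist_eq, Real.dist_eq]
    refine (abs_inv_add_sub_inv_add_le (by positivity) hu.2 hv.2).trans ?_
    refine mul_le_mul_of_nonneg_right ?_ (abs_nonneg _)
    rw [NNReal.coe_one, div_le_one (by positivity)]
    push_cast
    nlinarith [(Nat.cast_nonneg a : (0 : ℝ) ≤ a)]
  exact hlip.dimH_image_le.trans (dimH_mono inter_subset_left)

theorem dimH_iterate_gaussMap_preimage_le (A : Set ℝ) (n : ℕ) :
    dimH {x | x ∈ unitIrrationals ∧ gaussMap^[n] x ∈ A} ≤ dimH A := by
  induction n with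
  | zero => exact dimH_mono fun x hx => hx.2
  | succ n ih =>
    refine le_trans (dimH_mono ?_) ((dimH_gaussMap_preimage_le _).trans ih)
    rintro x ⟨hx, hA⟩
    exact ⟨hx, gaussMap_mem_unitIrrationals hx, hA⟩

/-! ### Exponent of convergence and the upper bound -/

theorem exists_tail_tsum_le_one {B : Set ℕ} {s : ℝ}
    (h : Summable (fun k : B => ((k : ℕ) : ℝ) ^ (-s))) :
    ∃ M : ℕ, ∑' k : {k | k ∈ B ∧ M ≤ k}, ENNReal.ofReal (((k : ℕ) : ℝ) ^ (-s)) ≤ 1 := by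
  set c : ℕ → ℝ≥0∞ := B.indicator fun k => ENNReal.ofReal ((k : ℝ) ^ (-s)) with hc
  have hfin : ∑' k, c k ≠ ∞ := by
    rw [hc, ← tsum_subtype B fun k => ENNReal.ofReal ((k : ℝ) ^ (-s))]
    exact h.tsum_ofReal_ne_top
  have ht := ENNReal.tendsto_sum_nat_add c hfin
  obtain ⟨M, hM⟩ := (ht.eventually (ge_mem_nhds zero_lt_one)).exists
  refine ⟨M, le_trans ?_ hM⟩
  set g : {k | k ∈ B ∧ M ≤ k} → ℕ := fun k => k - M with hg
  have hginj : Function.Injective g := fun k l hkl => by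
    have h1 := k.2.2
    have h2 := l.2.2
    simp only [hg] at hkl
    exact Subtype.ext (by omega)
  refine le_trans (le_of_eq (tsum_congr fun k => ?_))
    (ENNReal.tsum_comp_le_tsum_of_injective hginj fun i => c (i + M))
  have h1 : (k : ℕ) - M + M = k := Nat.sub_add_cancel k.2.2
  simp only [hg, h1, hc]
  rw [indicator_of_mem k.2.1]

theorem summable_rpow_neg_mono {B : Set ℕ} (hB : ∀ k ∈ B, 1 ≤ k) {s t : ℝ} (hst : s ≤ t)
    (h : Summable (fun k : B => ((k : ℕ) : ℝ) ^ (-s))) :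
    Summable (fun k : B => ((k : ℕ) : ℝ) ^ (-t)) := by
  refine Summable.of_nonneg_of_le (fun k => by positivity) (fun k => ?_) h
  exact Real.rpow_le_rpow_of_exponent_le (by exact_mod_cast hB k k.2) (by linarith)

theorem convergenceExponent_set_nonempty (B : Set ℕ) :
    {s : ℝ | 0 ≤ s ∧ Summable (fun k : B => ((k : ℕ) : ℝ) ^ (-s))}.Nonempty :=
  ⟨2, by norm_num, (Real.summable_nat_rpow.2 (by norm_num)).subtype B⟩

theorem convergenceExponent_nonneg (B : Set ℕ) : 0 ≤ convergenceExponent B :=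
  Real.sInf_nonneg fun _ h => h.1

theorem summable_of_convergenceExponent_lt {B : Set ℕ} (hB : ∀ k ∈ B, 1 ≤ k) {s : ℝ}
    (hs : convergenceExponent B < s) : Summable (fun k : B => ((k : ℕ) : ℝ) ^ (-s)) := by
  obtain ⟨t, ht, hts⟩ := exists_lt_of_csInf_lt (convergenceExponent_set_nonempty B) hs
  exact summable_rpow_neg_mono hB hts.le ht.2

theorem not_summable_of_lt_convergenceExponent {B : Set ℕ} {s : ℝ} (h0 : 0 ≤ s)
    (hs : s < convergenceExponent B) : ¬ Summable (fun k : B => ((k : ℕ) : ℝ) ^ (-s)) :=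
  fun h => hs.not_ge (csInf_le ⟨0, fun _ h => h.1⟩ ⟨h0, h⟩)

theorem dimH_restrictedSlowSet_le {B : Set ℕ} (hB : ∀ k ∈ B, 1 ≤ k) (f : ℕ → ℝ) :
    dimH (restrictedSlowSet B f) ≤ ENNReal.ofReal (convergenceExponent B / 2) := by
  have key : ∀ s, convergenceExponent B < s →
      dimH (restrictedSlowSet B f) ≤ ENNReal.ofReal (s / 2) := by
    intro s hs
    obtain ⟨M, hM⟩ := exists_tail_tsum_le_one (summable_of_convergenceExponent_lt hB hs)
    set S : Set ℕ := {k | k ∈ B ∧ max M 2 ≤ k} with hS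
    have hsum : ∑' k : S, ENNReal.ofReal (((k : ℕ) : ℝ) ^ (-s)) ≤ 1 := by
      refine le_trans ?_ hM
      exact ENNReal.tsum_mono_subtype (fun k : ℕ => ENNReal.ofReal ((k : ℝ) ^ (-s)))
        fun k hk => ⟨hk.1, (le_max_left _ _).trans hk.2⟩
    have hdim := dimH_digitSet_le (fun k hk => (le_max_right _ _).trans hk.2)
      ((convergenceExponent_nonneg B).trans hs.le) hsum
    have hsub : restrictedSlowSet B f ⊆
        ⋃ N : ℕ, {x | x ∈ unitIrrationals ∧ gaussMap^[N] x ∈ digitSet S} := by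
      rintro x ⟨hx, hxB, hlim⟩
      obtain ⟨N, hN⟩ := eventually_atTop.1 (hlim.eventually_ge_atTop (max M 2))
      refine mem_iUnion.2 ⟨N, hx, iterate_gaussMap_mem_unitIrrationals hx N, fun n => ?_⟩
      rw [partialQuotient_iterate]
      exact ⟨(hxB _ (by omega)).1, hN _ (by omega)⟩
    refine (dimH_mono hsub).trans ?_
    rw [dimH_iUnion]
    exact iSup_le fun N => (dimH_iterate_gaussMap_preimage_le _ N).trans hdim
  have hcont : Tendsto (fun s : ℝ => ENNReal.ofReal (s / 2)) (𝓝[>] (convergenceExponent B))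
      (𝓝 (ENNReal.ofReal (convergenceExponent B / 2))) :=
    ((ENNReal.continuous_ofReal.comp (continuous_id.div_const 2)).tendsto _).mono_left
      nhdsWithin_le_nhds
  exact ge_of_tendsto hcont (eventually_mem_nhdsWithin.mono key)

/-! ### Continued fractions with prescribed partial quotients -/

/-- `x` is the sequence of tails of the continued fraction with partial quotients `a`. -/
def IsTailSequence (a : ℕ → ℕ) (x : ℕ → ℝ) : Prop :=
  ∀ k, x k ∈ Icc (0 : ℝ) 1 ∧ x k * (a k + x (k + 1)) = 1

theorem exists_partial_tailSequence {a : ℕ → ℕ} (ha : ∀ k, 1 ≤ a k) (n : ℕ) :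
    ∃ x : ℕ → ℝ, (∀ k, x k ∈ Icc (0 : ℝ) 1) ∧ ∀ k < n, x k * (a k + x (k + 1)) = 1 := by
  induction n generalizing a with
  | zero => exact ⟨fun _ => 0, fun _ => by simp, by simp⟩
  | succ n ih =>
    obtain ⟨x, hx, h⟩ := ih (a := fun k => a (k + 1)) fun k => ha _
    have h1 : (1 : ℝ) ≤ a 0 := by exact_mod_cast ha 0
    have h0 := (hx 0).1
    refine ⟨fun k => Nat.casesOn k (1 / (a 0 + x 0)) x, fun k => ?_, fun k hk => ?_⟩
    · cases k with
      | zero =>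
        change 1 / (a 0 + x 0) ∈ Icc (0 : ℝ) 1
        refine ⟨by positivity, ?_⟩
        rw [div_le_one (by positivity)]
        linarith
      | succ k => exact hx k
    · cases k with
      | zero => exact one_div_mul_cancel (by positivity)
      | succ k => exact h k (by omega)

/-- Compactness of `[0, 1]^ℕ`: the sequences satisfying the first `n` relations form nested nonempty
closed sets, so convergents are not needed. -/
theorem exists_isTailSequence {a : ℕ → ℕ} (ha : ∀ k, 1 ≤ a k) : ∃ x, IsTailSequence a x := by
  set K : ℕ → Set (ℕ → ℝ) := fun n =>
    univ.pi (fun _ => Icc (0 : ℝ) 1) ∩ {x | ∀ k < n, x k * (a k + x (k + 1)) = 1} with hK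
  have hclosed : ∀ n, IsClosed (K n) := by
    intro n
    refine (isClosed_set_pi fun _ _ => isClosed_Icc).inter ?_
    simp only [ofPred_forall]
    exact isClosed_iInter fun k => isClosed_iInter fun _ =>
      isClosed_eq (by fun_prop) continuous_const
  obtain ⟨x, hx⟩ := IsCompact.nonempty_iInter_of_sequence_nonempty_isCompact_isClosed K
    (fun n x hx => ⟨hx.1, fun k hk => hx.2 k (by omega)⟩)
    (fun n => by
      obtain ⟨x, hx, h⟩ := exists_partial_tailSequence ha n
      exact ⟨x, fun k _ => hx k, h⟩)
    ((isCompact_univ_pi fun _ => isCompact_Icc).inter_right (by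
      simp))
    hclosed
  rw [mem_iInter] at hx
  exact ⟨x, fun k => ⟨(hx 0).1 k trivial, (hx (k + 1)).2 k (by omega)⟩⟩

namespace IsTailSequence

variable {a : ℕ → ℕ} {x : ℕ → ℝ}

theorem pos (h : IsTailSequence a x) (k : ℕ) : 0 < x k := by
  refine lt_of_le_of_ne (h k).1.1 fun h0 => ?_
  have := (h k).2
  rw [← h0] at this
  simp at this

theorem add_pos (h : IsTailSequence a x) (k : ℕ) : 0 < a k + x (k + 1) := by
  have := h.pos (k + 1)
  positivity

theorem one_div_eq (h : IsTailSequence a x) (k : ℕ) : 1 / x k = a k + x (k + 1) := by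
  rw [div_eq_iff (h.pos k).ne']
  linarith [(h k).2]

theorem eq_one_div (h : IsTailSequence a x) (k : ℕ) : x k = 1 / (a k + x (k + 1)) := by
  rw [← h.one_div_eq, one_div_one_div]

theorem lt_one (h : IsTailSequence a x) {k : ℕ} (ha : 1 ≤ a k) : x k < 1 := by
  have h1 : (1 : ℝ) ≤ a k := by exact_mod_cast ha
  rw [h.eq_one_div, div_lt_one (h.add_pos k)]
  linarith [h.pos (k + 1)]

/-- Irrationality by descent: `x k = p / q` gives `x (k + 1) = (q - a k * p) / p`, with the smaller
denominator `p < q`. -/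
theorem mul_natCast_ne (h : IsTailSequence a x) (ha : ∀ k, 1 ≤ a k) (q : ℕ) :
    ∀ (k : ℕ) (p : ℤ), 0 < q → x k * q ≠ p := by
  induction q using Nat.strong_induction_on with
  | _ q ih =>
    intro k p hq hp
    have hq' : (0 : ℝ) < q := by exact_mod_cast hq
    have hp0 : (0 : ℝ) < p := hp ▸ mul_pos (h.pos k) hq'
    have hp0' : 0 < p := by exact_mod_cast hp0
    lift p to ℕ using hp0'.le
    have hpq : ((p : ℕ) : ℝ) < q := by
      push_cast at hp
      nlinarith [h.lt_one (ha k)]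
    refine ih p (by exact_mod_cast hpq) (k + 1) (q - a k * p) (by exact_mod_cast hp0') ?_
    push_cast at hp ⊢
    have := (h k).2
    rw [← hp]
    linear_combination (q : ℝ) * this

theorem mem_unitIrrationals (h : IsTailSequence a x) (ha : ∀ k, 1 ≤ a k) (k : ℕ) :
    x k ∈ unitIrrationals := by
  refine ⟨?_, h.pos k, h.lt_one (ha k)⟩
  rintro ⟨r, hr⟩
  refine h.mul_natCast_ne ha r.den k r.num r.pos ?_
  rw [← hr]
  exact_mod_cast Rat.mul_den_eq_num r

theorem gaussMap_eq (h : IsTailSequence a x) (ha : ∀ k, 1 ≤ a k) (k : ℕ) :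
    gaussMap (x k) = x (k + 1) := by
  rw [gaussMap_eq_fract, h.one_div_eq, Int.fract_natCast_add, Int.fract_eq_self]
  exact ⟨(h.pos _).le, h.lt_one (ha _)⟩

theorem iterate_gaussMap (h : IsTailSequence a x) (ha : ∀ k, 1 ≤ a k) (n : ℕ) :
    gaussMap^[n] (x 0) = x n := by
  induction n with
  | zero => rfl
  | succ n ih => rw [Function.iterate_succ_apply', ih, h.gaussMap_eq ha]

theorem partialQuotient_eq (h : IsTailSequence a x) (ha : ∀ k, 1 ≤ a k) (n : ℕ) :
    partialQuotient (x 0) (n + 1) = a n := by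
  rw [partialQuotient, Nat.add_sub_cancel, h.iterate_gaussMap ha, h.one_div_eq,
    add_comm, Nat.floor_add_natCast (h.pos _).le, Nat.floor_eq_zero.2 (h.lt_one (ha _)), zero_add]

theorem le_half (h : IsTailSequence a x) {k : ℕ} (ha : 2 ≤ a k) : x k ≤ 1 / 2 := by
  have h1 : (2 : ℝ) ≤ a k := by exact_mod_cast ha
  rw [h.eq_one_div]
  exact one_div_le_one_div_of_le two_pos (by linarith [h.pos (k + 1)])

theorem one_div_le {V : ℝ} (h : IsTailSequence a x) {k : ℕ} (ha : (a k : ℝ) + 1 ≤ V) :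
    1 / V ≤ x k := by
  rw [h.eq_one_div]
  exact one_div_le_one_div_of_le (h.add_pos k) (by linarith [(h (k + 1)).1.2])

/-- Two continued fractions which first differ in the partial quotient of index `n` are separated by
the product of the squares of the sizes of their partial quotients up to that index. -/
theorem prod_le_abs_sub {b : ℕ → ℕ} {y V : ℕ → ℝ} (hx : IsTailSequence a x)
    (hy : IsTailSequence b y) (hV0 : ∀ k, 0 < V k) (ha : ∀ k, (a k : ℝ) + 1 ≤ V k)
    (hb : ∀ k, (b k : ℝ) + 1 ≤ V k) {n : ℕ}
    (heq : ∀ k < n, a k = b k) (hne : a n ≠ b n) (ha2 : 2 ≤ a (n + 1)) (hb2 : 2 ≤ b (n + 1)) :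
    1 / 2 * ∏ k ∈ Finset.range (n + 1), (1 / V k) ^ 2 ≤ |x 0 - y 0| := by
  have hVV : ∀ k, (1 / V k) ^ 2 ≤ x k * y k := fun k => by
    have := hV0 k
    rw [sq]
    exact mul_le_mul (hx.one_div_le (ha k)) (hy.one_div_le (hb k)) (by positivity) (hx.pos k).le
  have hsub : ∀ k, |x k - y k| = x k * y k * |(b k + y (k + 1)) - (a k + x (k + 1))| := by
    intro k
    rw [← abs_of_nonneg (mul_pos (hx.pos k) (hy.pos k)).le, ← abs_mul]
    congr 1
    linear_combination (-x k) * (hy k).2 + y k * (hx k).2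
  -- Induction on the distance `m` from position `k` to the first differing digit. At that digit the
  -- integer parts differ by at least `1`, while both following tails lie in `(0, 1/2]`; this leaves
  -- the factor `1/2`.
  suffices H : ∀ m k, m + k = n →
      1 / 2 * ∏ i ∈ Finset.range (m + 1), (1 / V (k + i)) ^ 2 ≤ |x k - y k| by
    simpa using H n 0 rfl
  intro m
  induction m with
  | zero =>
    intro k hk
    obtain rfl : k = n := by omega
    rw [hsub, Finset.prod_range_one, mul_comm]
    refine mul_le_mul (hVV k) ?_ (by norm_num) (mul_pos (hx.pos k) (hy.pos k)).le
    have hab : (1 : ℝ) ≤ |(b k : ℝ) - a k| := by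
      have : (1 : ℤ) ≤ |(b k : ℤ) - a k| := Int.one_le_abs (by omega)
      exact_mod_cast this
    have h1 := hx.le_half ha2
    have h2 := hy.le_half hb2
    have h3 := hx.pos (k + 1)
    have h4 := hy.pos (k + 1)
    rcases le_abs.1 hab with h | h
    · exact le_abs.2 (Or.inl (by linarith))
    · exact le_abs.2 (Or.inr (by linarith))
  | succ m ih =>
    intro k hk
    have := ih (k + 1) (by omega)
    rw [hsub, Finset.prod_range_succ', heq k (by omega), add_sub_add_left_eq_sub, abs_sub_comm,
      mul_comm (Finset.prod _ _), mul_left_comm]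
    refine mul_le_mul (hVV k) ?_ (by positivity) (mul_pos (hx.pos k) (hy.pos k)).le
    simpa only [add_assoc, add_comm 1] using this

end IsTailSequence

/-! ### Large finite blocks in `B` and slow passage through stages -/

section Counting

-- If the count stayed below `n^s`, the `j`-th element of `B` would exceed about `j^(1/s)`, and the
-- series with exponent `t > s` would converge.
open Classical in
theorem exists_rpow_le_count {B : Set ℕ} (hBinf : B.Infinite) {s t : ℝ}
    (hs : 0 < s) (hst : s < t) (h : ¬ Summable (fun k : B => ((k : ℕ) : ℝ) ^ (-t))) (n₀ : ℕ) :
    ∃ n ≥ n₀, (n : ℝ) ^ s ≤ Nat.count (· ∈ B) (n + 1) := by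
  by_contra! hlt
  refine h ?_
  have : Infinite B := hBinf.to_subtype
  rw [← (Nat.Subtype.orderIsoOfNat B).toEquiv.summable_iff, ← summable_nat_add_iff n₀]
  have hsum : Summable fun k : ℕ => ((k + (n₀ + 1) : ℕ) : ℝ) ^ (-(t / s)) := by
    rw [summable_nat_add_iff (f := fun k : ℕ => (k : ℝ) ^ (-(t / s))) (n₀ + 1),
      Real.summable_nat_rpow]
    linarith [(one_lt_div hs).2 hst]
  refine Summable.of_nonneg_of_le (fun k => Real.rpow_nonneg (Nat.cast_nonneg _) _)
    (fun k => ?_) hsum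
  have hBi : (Set.ofPred (· ∈ B)).Infinite := hBinf
  have hnth : ((Nat.Subtype.orderIsoOfNat B (k + n₀) : B) : ℕ) = Nat.nth (· ∈ B) (k + n₀) :=
    (Nat.nth_apply_eq_orderIsoOfNat hBi _).symm
  simp only [Function.comp_apply, RelIso.coe_fn_toEquiv, hnth]
  set b := Nat.nth (· ∈ B) (k + n₀) with hb
  have hkb : k + n₀ ≤ b := (Nat.nth_strictMono hBi).le_apply
  have hc := hlt b (by omega)
  rw [hb, Nat.count_nth_succ_of_infinite hBi, ← hb] at hc
  have : (b : ℝ) ^ (-t) = ((b : ℝ) ^ s) ^ (-(t / s)) := by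
    rw [← Real.rpow_mul (by positivity)]
    congr 1
    field_simp
  rw [this]
  refine Real.rpow_le_rpow_of_nonpos (by positivity) hc.le ?_
  have : 0 < t / s := div_pos (hs.trans hst) hs
  linarith

/-- A set of exponent of convergence larger than `s` has finite subsets of arbitrarily large numbers
whose size exceeds the `s`-th power of their maximum. -/
theorem exists_block {B : Set ℕ} (hBinf : B.Infinite) {s : ℝ}
    (hs : 0 < s) (hsB : s < convergenceExponent B) (L : ℕ) :
    ∃ (F : Finset ℕ) (V : ℝ), (∀ k ∈ F, k ∈ B ∧ L ≤ k ∧ (k : ℝ) + 1 ≤ V) ∧ 0 < V ∧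
      2 * V ^ s ≤ F.card := by
  classical
  -- With `s < r < t < τ(B)`, at least `n^r` elements of `B` are at most `n`. The surplus `n^(r -
  -- s)` absorbs the constant `2 * 2^s` and the at most `L ≤ n^s` elements discarded below `L`.
  obtain ⟨t, hst, htB⟩ := exists_between hsB
  obtain ⟨r, hsr, hrt⟩ := exists_between hst
  have e1 : ∀ᶠ n : ℕ in atTop, 2 * 2 ^ s + 1 ≤ (n : ℝ) ^ (r - s) :=
    ((tendsto_rpow_atTop (sub_pos.2 hsr)).comp tendsto_natCast_atTop_atTop).eventually_ge_atTop _
  have e2 : ∀ᶠ n : ℕ in atTop, (L : ℝ) ≤ (n : ℝ) ^ s :=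
    ((tendsto_rpow_atTop hs).comp tendsto_natCast_atTop_atTop).eventually_ge_atTop _
  obtain ⟨n₀, hn₀⟩ := eventually_atTop.1 (e1.and (e2.and (eventually_ge_atTop 1)))
  obtain ⟨n, hn, hcount⟩ := exists_rpow_le_count hBinf (hs.trans hsr) hrt
    (not_summable_of_lt_convergenceExponent (hs.trans hst).le htB) n₀
  obtain ⟨h1, h2, h3⟩ := hn₀ n hn
  have hn1 : (1 : ℝ) ≤ n := by exact_mod_cast h3
  set G := (Finset.range (n + 1)).filter (· ∈ B) with hG
  refine ⟨G \ Finset.range L, n + 1, fun k hk => ?_, by positivity, ?_⟩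
  · simp only [hG, Finset.mem_sdiff, Finset.mem_filter, Finset.mem_range, not_lt] at hk
    refine ⟨hk.1.2, hk.2, ?_⟩
    have : (k : ℝ) ≤ n := by exact_mod_cast Nat.lt_succ_iff.1 hk.1.1
    linarith
  · have hcard : (G.card : ℝ) ≤ (G \ Finset.range L).card + L := by
      have := Finset.card_le_card_sdiff_add_card (s := G) (t := Finset.range L)
      rw [Finset.card_range] at this
      exact_mod_cast this
    rw [Nat.count_eq_card_filter_range, ← hG] at hcount
    have hpow : ((n : ℝ) + 1) ^ s ≤ 2 ^ s * (n : ℝ) ^ s := by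
      rw [← Real.mul_rpow two_pos.le (by positivity)]
      exact Real.rpow_le_rpow (by positivity) (by linarith) hs.le
    have hsplit : (n : ℝ) ^ r = (n : ℝ) ^ s * (n : ℝ) ^ (r - s) := by
      rw [← Real.rpow_add (by positivity)]
      congr 1
      ring
    have hns : 0 ≤ (n : ℝ) ^ s := by positivity
    nlinarith [mul_le_mul_of_nonneg_left h1 hns]

end Counting

/-- If each stage `k` is eventually admissible, one may pass through the stages so slowly that the
stage at time `i` is admissible for all large `i`. -/
theorem exists_slow_tendsto {P : ℕ → ℕ → Prop} (hP : ∀ k, ∀ᶠ i in atTop, P k i) :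
    ∃ κ : ℕ → ℕ, Tendsto κ atTop atTop ∧ ∀ᶠ i in atTop, P (κ i) i := by
  classical
  refine ⟨fun i => Nat.findGreatest (fun k => P k i) i, tendsto_atTop.2 fun K => ?_, ?_⟩
  · filter_upwards [hP K, eventually_ge_atTop K] with i hi hKi
    exact Nat.le_findGreatest hKi hi
  · filter_upwards [hP 0] with i hi
    exact Nat.findGreatest_spec (P := fun k => P k i) (Nat.zero_le i) hi

/-! ### Mixed radix expansions -/

/-- The remainders of the mixed radix expansion of `y` with radices `m`. -/
noncomputable def radixOrbit (m : ℕ → ℕ) (y : ℝ) : ℕ → ℝ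
  | 0 => y
  | k + 1 => Int.fract (m k * radixOrbit m y k)

/-- The digits of the mixed radix expansion of `y` with radices `m`. -/
noncomputable def radixDigit (m : ℕ → ℕ) (y : ℝ) (k : ℕ) : ℕ := ⌊m k * radixOrbit m y k⌋₊

section Radix

variable {m : ℕ → ℕ} {y z : ℝ}

theorem radixOrbit_mem_Ico (hy : y ∈ Ico (0 : ℝ) 1) (k : ℕ) :
    radixOrbit m y k ∈ Ico (0 : ℝ) 1 := by
  cases k with
  | zero => exact hy
  | succ k => exact ⟨Int.fract_nonneg _, Int.fract_lt_one _⟩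

theorem radixDigit_lt (hy : y ∈ Ico (0 : ℝ) 1) {k : ℕ} (hm : 0 < m k) :
    radixDigit m y k < m k := by
  have hm' : (0 : ℝ) < m k := by exact_mod_cast hm
  have h := radixOrbit_mem_Ico (m := m) hy k
  rw [radixDigit, Nat.floor_lt (mul_nonneg hm'.le h.1)]
  nlinarith [h.2]

theorem radixOrbit_succ (hy : y ∈ Ico (0 : ℝ) 1) (k : ℕ) :
    radixOrbit m y (k + 1) = m k * radixOrbit m y k - radixDigit m y k := by
  rw [radixOrbit, radixDigit, natCast_floor_eq_intCast_floor
    (mul_nonneg (Nat.cast_nonneg _) (radixOrbit_mem_Ico hy k).1)]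
  rfl

theorem prod_mul_sub_eq (hy : y ∈ Ico (0 : ℝ) 1) (hz : z ∈ Ico (0 : ℝ) 1) {n : ℕ}
    (h : ∀ k < n, radixDigit m y k = radixDigit m z k) :
    (∏ k ∈ Finset.range n, (m k : ℝ)) * (y - z) = radixOrbit m y n - radixOrbit m z n := by
  induction n with
  | zero => simp [radixOrbit]
  | succ n ih =>
    rw [Finset.prod_range_succ, radixOrbit_succ hy, radixOrbit_succ hz, h n n.lt_succ_self]
    linear_combination (m n : ℝ) * ih fun k hk => h k (by omega)

theorem prod_mul_abs_sub_le (hy : y ∈ Ico (0 : ℝ) 1) (hz : z ∈ Ico (0 : ℝ) 1) {n : ℕ}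
    (h : ∀ k < n, radixDigit m y k = radixDigit m z k) :
    (∏ k ∈ Finset.range n, (m k : ℝ)) * |y - z| ≤ 1 := by
  have h0 : (0 : ℝ) ≤ ∏ k ∈ Finset.range n, (m k : ℝ) := by positivity
  rw [← abs_of_nonneg h0, ← abs_mul, prod_mul_sub_eq hy hz h, abs_le]
  have h1 := radixOrbit_mem_Ico (m := m) hy n
  have h2 := radixOrbit_mem_Ico (m := m) hz n
  constructor <;> linarith [h1.1, h1.2, h2.1, h2.2]

end Radix

/-! ### Lower bound: Hölder decoding -/

/-- The inverse of `φ` on `I` is `t`-Hölder, hence `1 = dimH I ≤ dimH (φ '' I) / t`. -/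
theorem le_dimH_image_of_abs_sub_le {φ : ℝ → ℝ} {I : Set ℝ} {C t : ℝ} (ht : 0 < t) (hC : 0 ≤ C)
    (hI : dimH I = 1) (h : ∀ y ∈ I, ∀ z ∈ I, |y - z| ≤ C * |φ y - φ z| ^ t) :
    ENNReal.ofReal t ≤ dimH (φ '' I) := by
  have hinj : InjOn φ I := fun y hy z hz hyz => by
    have := h y hy z hz
    rw [hyz, sub_self, abs_zero, Real.zero_rpow ht.ne', mul_zero] at this
    exact sub_eq_zero.1 (abs_eq_zero.1 (le_antisymm this (abs_nonneg _)))
  have hinv : ∀ y ∈ I, Function.invFunOn φ I (φ y) = y := fun y hy =>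
    hinj.leftInvOn_invFunOn hy
  have hhol : HolderOnWith C.toNNReal t.toNNReal (Function.invFunOn φ I) (φ '' I) := by
    rintro _ ⟨y, hy, rfl⟩ _ ⟨z, hz, rfl⟩
    rw [hinv y hy, hinv z hz, edist_dist, edist_dist, Real.dist_eq, Real.dist_eq,
      Real.coe_toNNReal _ ht.le, ENNReal.ofReal_rpow_of_nonneg (abs_nonneg _) ht.le]
    change _ ≤ ENNReal.ofReal C * _
    rw [← ENNReal.ofReal_mul hC]
    exact ENNReal.ofReal_le_ofReal (h y hy z hz)
  have himage : Function.invFunOn φ I '' (φ '' I) = I := by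
    rw [image_image]
    exact (image_congr hinv).trans (image_id' I)
  have hdim := hhol.dimH_image_le (Real.toNNReal_pos.2 ht)
  rw [himage, hI, ENNReal.le_div_iff_mul_le (Or.inl (by simpa using ht)) (Or.inl (by simp)),
    one_mul] at hdim
  exact hdim

/-- A lower bound for the dimension of a set of continued fractions whose partial quotients range
over prescribed finite sets. -/
theorem le_dimH_of_blocks {F : ℕ → Finset ℕ} {V : ℕ → ℝ} {t C : ℝ} {N : ℕ} (ht : 0 < t)
    (hne : ∀ i, (F i).Nonempty) (hpos : ∀ i, ∀ k ∈ F i, 1 ≤ k)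
    (hV : ∀ i, ∀ k ∈ F i, (k : ℝ) + 1 ≤ V i) (hN : ∀ i < N, (F i).card = 1)
    (h2 : ∀ i, N ≤ i → ∀ k ∈ F i, 2 ≤ k) (hC : 0 ≤ C)
    (hmass : ∀ n, N ≤ n → (∏ i ∈ Finset.range (n + 1), V i) ^ (2 * t) ≤
      C * ∏ i ∈ Finset.range n, ((F i).card : ℝ)) :
    ENNReal.ofReal t ≤ dimH {x | x ∈ unitIrrationals ∧ ∀ n, partialQuotient x (n + 1) ∈ F n} := by
  set m : ℕ → ℕ := fun i => (F i).card with hm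
  have hm0 : ∀ i, 0 < m i := fun i => (hne i).card_pos
  have hV2 : ∀ i, 2 ≤ V i := fun i => by
    obtain ⟨k, hk⟩ := hne i
    have h1 : (1 : ℝ) ≤ k := by exact_mod_cast hpos i k hk
    linarith [hV i k hk]
  have henum : ∀ i, ∃ e : ℕ → ℕ, (∀ d < m i, e d ∈ F i) ∧ InjOn e (Iio (m i)) := fun i => by
    refine ⟨fun d => if h : d < m i then (F i).equivFin.symm ⟨d, h⟩ else 0, fun d hd => ?_,
      fun d hd d' hd' h => ?_⟩
    · simp [hd]
    · rw [mem_Iio] at hd hd'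
      simpa [hd, hd', Subtype.ext_iff.symm] using h
  choose e heF heinj using henum
  set a : ℝ → ℕ → ℕ := fun y k => e k (radixDigit m y k) with ha
  have haF : ∀ y ∈ Ico (0 : ℝ) 1, ∀ k, a y k ∈ F k := fun y hy k =>
    heF k _ (radixDigit_lt hy (hm0 k))
  have hex : ∀ y, ∃ x, y ∈ Ico (0 : ℝ) 1 → IsTailSequence (a y) x := fun y => by
    by_cases hy : y ∈ Ico (0 : ℝ) 1
    · obtain ⟨x, hx⟩ := exists_isTailSequence fun k => hpos k _ (haF y hy k)
      exact ⟨x, fun _ => hx⟩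
    · exact ⟨0, fun h => absurd h hy⟩
  choose X hX using hex
  have hdist : ∀ y ∈ Ico (0 : ℝ) 1, ∀ z ∈ Ico (0 : ℝ) 1,
      |y - z| ≤ (C * 2 ^ t) * |X y 0 - X z 0| ^ t := by
    intro y hy z hz
    rcases eq_or_ne y z with rfl | hyz
    · rw [sub_self, abs_zero]
      positivity
    have hyz' : 0 < |y - z| := abs_pos.2 (sub_ne_zero.2 hyz)
    have hbound : ∀ n, N ≤ n → (∀ k < n, radixDigit m y k = radixDigit m z k) →
        (∏ i ∈ Finset.range (n + 1), V i) ^ (2 * t) * |y - z| ≤ C := by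
      intro n hn h
      have h1 := prod_mul_abs_sub_le hy hz h
      have h3 := mul_le_mul_of_nonneg_right (hmass n hn) hyz'.le
      rw [mul_assoc] at h3
      exact h3.trans (mul_le_of_le_one_right hC h1)
    have hdiff : ∃ n, radixDigit m y n ≠ radixDigit m z n := by
      -- Radices equal to `1` are allowed, so distinct points do not differ in a digit
      -- automatically. If all digits agreed, `hbound` would hold for every `n ≥ N`, although `V i ≥
      -- 2` makes its left side unbounded.
      by_contra! hall
      have htend : Tendsto (fun n : ℕ => ((2 : ℝ) ^ (2 * t)) ^ (n + 1) * |y - z|) atTop atTop :=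
        ((tendsto_pow_atTop_atTop_of_one_lt
          (Real.one_lt_rpow one_lt_two (by positivity))).comp
          (tendsto_add_atTop_nat 1)).atTop_mul_const hyz'
      obtain ⟨n, hnC, hn⟩ := ((htend.eventually_gt_atTop C).and (eventually_ge_atTop N)).exists
      refine hnC.not_ge (le_trans ?_ (hbound n hn fun k _ => hall k))
      refine mul_le_mul_of_nonneg_right ?_ hyz'.le
      rw [← Real.rpow_natCast, ← Real.rpow_mul two_pos.le, mul_comm (2 * t), Real.rpow_mul two_pos.le,
        Real.rpow_natCast]
      refine Real.rpow_le_rpow (by positivity) ?_ (by positivity)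
      calc (2 : ℝ) ^ (n + 1) = ∏ _i ∈ Finset.range (n + 1), (2 : ℝ) := by simp
        _ ≤ _ := Finset.prod_le_prod (fun _ _ => by norm_num) fun i _ => hV2 i
    classical
    set n := Nat.find hdiff with hn
    have hlt : ∀ k < n, radixDigit m y k = radixDigit m z k := fun k hk =>
      not_not.1 (Nat.find_min hdiff hk)
    -- Before `N` the radix is `1` and the only digit is `0`.
    have hNn : N ≤ n := by
      by_contra! h
      have h1 : m n = 1 := hN n h
      have h3 := radixDigit_lt hy (hm0 n)
      have h4 := radixDigit_lt hz (hm0 n)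
      rw [h1, Nat.lt_one_iff] at h3 h4
      exact Nat.find_spec hdiff (h3.trans h4.symm)
    have hP : 0 < ∏ i ∈ Finset.range (n + 1), V i :=
      Finset.prod_pos fun i _ => by linarith [hV2 i]
    set P := ∏ i ∈ Finset.range (n + 1), V i
    have hsep := (hX y hy).prod_le_abs_sub (hX z hz) (V := V) (n := n)
      (fun k => by linarith [hV2 k]) (fun k => hV k _ (haF y hy k)) (fun k => hV k _ (haF z hz k))
      (fun k hk => by simp only [ha, hlt k hk])
      (fun h => Nat.find_spec hdiff (heinj n (radixDigit_lt hy (hm0 n))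
        (radixDigit_lt hz (hm0 n)) h))
      (h2 _ (by omega) _ (haF y hy _)) (h2 _ (by omega) _ (haF z hz _))
    have hprod : ∏ k ∈ Finset.range (n + 1), (1 / V k) ^ 2 = (P ^ 2)⁻¹ := by
      rw [Finset.prod_pow, Finset.prod_div_distrib, Finset.prod_const_one, one_div, inv_pow]
    rw [hprod] at hsep
    have hone : 1 ≤ 2 * P ^ 2 * |X y 0 - X z 0| := by
      have := mul_le_mul_of_nonneg_left hsep (show 0 ≤ 2 * P ^ 2 by positivity)
      refine le_trans (le_of_eq ?_) this
      field_simp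
    have hpow : 1 ≤ 2 ^ t * P ^ (2 * t) * |X y 0 - X z 0| ^ t := by
      have := Real.one_le_rpow hone ht.le
      rwa [Real.mul_rpow (by positivity) (abs_nonneg _), Real.mul_rpow two_pos.le (by positivity),
        ← Real.rpow_natCast P, ← Real.rpow_mul hP.le, Nat.cast_ofNat] at this
    calc |y - z| ≤ |y - z| * (2 ^ t * P ^ (2 * t) * |X y 0 - X z 0| ^ t) :=
          le_mul_of_one_le_right hyz'.le hpow
      _ = (P ^ (2 * t) * |y - z|) * (2 ^ t * |X y 0 - X z 0| ^ t) := by ring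
      _ ≤ C * (2 ^ t * |X y 0 - X z 0| ^ t) :=
          mul_le_mul_of_nonneg_right (hbound n hNn hlt) (by positivity)
      _ = _ := by ring
  have hI : dimH (Ico (0 : ℝ) 1) = 1 := by
    rw [Real.dimH_of_nonempty_interior (by rw [interior_Ico]; exact nonempty_Ioo.2 one_pos),
      Module.finrank_self, Nat.cast_one]
  refine (le_dimH_image_of_abs_sub_le (φ := fun y => X y 0) ht (by positivity) hI hdist).trans
    (dimH_mono ?_)
  rintro _ ⟨y, hy, rfl⟩
  have hay : ∀ k, 1 ≤ a y k := fun k => hpos k _ (haF y hy k)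
  refine ⟨(hX y hy).mem_unitIrrationals hay 0, fun n => ?_⟩
  rw [(hX y hy).partialQuotient_eq hay]
  exact haF y hy n

theorem le_dimH_restrictedSlowSet {B : Set ℕ} (hB : ∀ k ∈ B, 1 ≤ k) (hBinf : B.Infinite)
    {f : ℕ → ℝ} (hfmin : ∀ n : ℕ, 1 ≤ n → ((sInf B : ℕ) : ℝ) ≤ f n)
    (hf : Tendsto f atTop atTop) {s : ℝ} (hs : 0 < s) (hsB : s < convergenceExponent B) :
    ENNReal.ofReal (s / 2) ≤ dimH (restrictedSlowSet B f) := by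
  -- Digits in block `k` are at least `k + 2`: they tend to infinity with `k`, and are at least `2`
  -- as the separation estimate requires.
  choose F V hFV hV0 hcard using fun k : ℕ => exists_block hBinf hs hsB (k + 2)
  obtain ⟨κ, hκ, hκP⟩ := exists_slow_tendsto
    (P := fun k i => V k ≤ f (i + 1) ∧ V k ^ s ≤ 2 ^ i) fun k =>
      ((hf.comp (tendsto_add_atTop_nat 1)).eventually_ge_atTop _).and
        ((tendsto_pow_atTop_atTop_of_one_lt one_lt_two).eventually_ge_atTop _)
  obtain ⟨N, hN⟩ := eventually_atTop.1 hκP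
  -- Until the blocks become admissible, the digit is `min B`, which `f` always allows.
  set F' : ℕ → Finset ℕ := fun i => if i < N then {sInf B} else F (κ i) with hF'
  set V' : ℕ → ℝ := fun i => if i < N then (sInf B : ℕ) + 1 else V (κ i) with hV'
  have hF'lt : ∀ i < N, F' i = {sInf B} := fun i hi => if_pos hi
  have hF'ge : ∀ i, N ≤ i → F' i = F (κ i) := fun i hi => if_neg hi.not_gt
  have hV'lt : ∀ i < N, V' i = (sInf B : ℕ) + 1 := fun i hi => if_pos hi
  have hV'ge : ∀ i, N ≤ i → V' i = V (κ i) := fun i hi => if_neg hi.not_gt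
  have hmin : sInf B ∈ B := Nat.sInf_mem hBinf.nonempty
  have hF'B : ∀ i, ∀ k ∈ F' i, k ∈ B ∧ (k : ℝ) ≤ f (i + 1) := by
    intro i k hk
    rcases lt_or_ge i N with hi | hi
    · rw [hF'lt i hi, Finset.mem_singleton] at hk
      exact hk ▸ ⟨hmin, hfmin _ (by omega)⟩
    · rw [hF'ge i hi] at hk
      have h := hFV _ k hk
      exact ⟨h.1, by linarith [h.2.2, (hN i hi).1]⟩
  have hV'0 : ∀ i, 0 < V' i := by
    intro i
    rcases lt_or_ge i N with hi | hi
    · rw [hV'lt i hi]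
      positivity
    · rw [hV'ge i hi]
      exact hV0 _
  have hprod0 : ∀ n, 0 ≤ ∏ i ∈ Finset.range n, V' i := fun n =>
    Finset.prod_nonneg fun i _ => (hV'0 i).le
  -- The constant pays for the first `N` places, where the blocks are singletons; from `N` on each
  -- place gains a factor `2`.
  set C : ℝ := (∏ i ∈ Finset.range N, V' i) ^ s * 2 ^ N with hC
  have hgrow : ∀ n, N ≤ n → (∏ i ∈ Finset.range n, V' i) ^ s * 2 ^ n ≤
      C * ∏ i ∈ Finset.range n, ((F' i).card : ℝ) := by
    intro n hn
    induction n, hn using Nat.le_induction with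
    | base =>
      rw [Finset.prod_eq_one (f := fun i => ((F' i).card : ℝ)) fun i hi => by
        rw [hF'lt i (Finset.mem_range.1 hi), Finset.card_singleton, Nat.cast_one], mul_one]
    | succ n hn ih =>
      rw [Finset.prod_range_succ, Finset.prod_range_succ, Real.mul_rpow (hprod0 n) (hV'0 n).le]
      have hc := hcard (κ n)
      rw [← hV'ge n hn, ← hF'ge n hn] at hc
      have := mul_le_mul ih hc (mul_nonneg two_pos.le (Real.rpow_nonneg (hV'0 n).le s))
        ((mul_nonneg (Real.rpow_nonneg (hprod0 n) s) (by positivity)).trans ih)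
      refine le_trans (le_of_eq ?_) (this.trans_eq (mul_assoc _ _ _))
      ring
  have hdim := le_dimH_of_blocks (F := F') (V := V') (t := s / 2) (C := C) (N := N)
    (half_pos hs)
    (fun i => by
      rcases lt_or_ge i N with hi | hi
      · rw [hF'lt i hi]
        exact Finset.singleton_nonempty _
      · rw [hF'ge i hi, ← Finset.card_pos, ← Nat.cast_pos (α := ℝ)]
        exact lt_of_lt_of_le (mul_pos two_pos (Real.rpow_pos_of_pos (hV0 _) s)) (hcard _))
    (fun i k hk => hB k (hF'B i k hk).1)
    (fun i k hk => by
      rcases lt_or_ge i N with hi | hi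
      · rw [hF'lt i hi, Finset.mem_singleton] at hk
        rw [hV'lt i hi, hk]
      · rw [hF'ge i hi] at hk
        rw [hV'ge i hi]
        exact (hFV _ k hk).2.2)
    (fun i hi => by rw [hF'lt i hi, Finset.card_singleton])
    (fun i hi k hk => by
      rw [hF'ge i hi] at hk
      have := (hFV _ k hk).2.1
      omega)
    (mul_nonneg (Real.rpow_nonneg (hprod0 N) s) (by positivity))
    (fun n hn => by
      refine le_trans ?_ (hgrow n hn)
      rw [mul_div_cancel₀ s two_ne_zero, Finset.prod_range_succ,
        Real.mul_rpow (hprod0 n) (hV'0 n).le]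
      -- The accumulated `2^n` dominates the one unmatched factor `V' n ^ s`.
      refine mul_le_mul_of_nonneg_left ?_ (Real.rpow_nonneg (hprod0 n) s)
      rw [hV'ge n hn]
      exact (hN n hn).2)
  refine hdim.trans (dimH_mono ?_)
  rintro x ⟨hx, hxF⟩
  refine ⟨hx, fun n hn => ?_, ?_⟩
  · obtain ⟨i, rfl⟩ := Nat.exists_eq_add_of_le' hn
    exact hF'B i _ (hxF i)
  · rw [← tendsto_add_atTop_iff_nat 1]
    refine tendsto_atTop_mono' _ ?_ hκ
    filter_upwards [eventually_ge_atTop N] with i hi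
    have h := hxF i
    rw [hF'ge i hi] at h
    have := (hFV _ _ h).2.1
    omega

theorem theorem1 (B : Set ℕ) (hBpos : ∀ k ∈ B, 1 ≤ k) (hBinf : B.Infinite)
    (f : ℕ → ℝ) (hfmin : ∀ n : ℕ, 1 ≤ n → ((sInf B : ℕ) : ℝ) ≤ f n)
    (hf : Filter.Tendsto f Filter.atTop Filter.atTop) :
    dimH (restrictedSlowSet B f) = ENNReal.ofReal (convergenceExponent B / 2) := by
  refine le_antisymm (dimH_restrictedSlowSet_le hBpos f) ?_
  rcases (convergenceExponent_nonneg B).eq_or_lt with h0 | h0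
  · rw [← h0, zero_div, ENNReal.ofReal_zero]
    exact zero_le
  have hcont : Tendsto (fun s : ℝ => ENNReal.ofReal (s / 2)) (𝓝[<] (convergenceExponent B))
      (𝓝 (ENNReal.ofReal (convergenceExponent B / 2))) :=
    ((ENNReal.continuous_ofReal.comp (continuous_id.div_const 2)).tendsto _).mono_left
      nhdsWithin_le_nhds
  refine le_of_tendsto hcont ?_
  filter_upwards [Ioo_mem_nhdsLT h0] with s hs
  exact le_dimH_restrictedSlowSet hBpos hBinf hfmin hf hs.1 hs.2
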